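/- Let $G$ be a compact Hausdorff topological group with a countable basis, and let $\mu=(\mu_k)_{k\in-\mathbb N}$, $\mathbb N=\{0,1,2,\dots\}$, be a family of Borel probability laws on $G$. A *solution* (with noise law $\mu$) is a pair of $G$-valued processes $\{(\eta_k)_{k\in-\mathbb N},(\xi_k)_{k\in-\mathbb N}\}$ on a probability space such that, for every $k\in-\mathbb N$, $\eta_k=\xi_k\eta_{k-1}$ a.s., $\xi_k$ is independent of $\mathcal F^\eta_{k-1}$, and $\xi_k$ has law $\mu_k$. Here $\mathcal F^X_k=\sigma(X_m:m\le k)$. A solution is *extremal* if the law of $(\eta_k)$ on $G^{-\mathbb N}$ is an extreme point of the convex set $\mathscr P_\mu$ of the laws of $(\eta_k)$ for all solutions with noise law $\mu$. For a compact subgroup $H$ of $G$, $\omega_H$ denotes the normalized Haar measure of $H$ (regarded as a law on $G$), $G/H$ is the space of left cosets with the quotient topology, and "uniform on $H$" means "with law $\omega_H$". Let $(\lambda_k)_{k\in-\mathbb N}$ be probability laws on $G$, $(\alpha_l)_{l\in-\mathbb N}$ elements of $G$ and $H$ a compact subgroup of $G$ such that 1. $\mu_k*\mu_{k-1}*\cdots*\mu_l*\delta_{\alpha_l}\to\lambda_k$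 weakly as $l\to-\infty$, for each $k\in-\mathbb N$; 2. $\delta_{\alpha_l^{-1}}*\lambda_{l-1}\to\omega_H$ weakly as $l\to-\infty$; 3. $\lambda_k*\delta_h=\lambda_k$ for each $h\in H$ and each $k\in-\mathbb N$; 4. whenever $(\xi_k)$ are independent random variables with $\xi_k$ of law $\mu_k$, then for each $k\in-\mathbb N$ the coset $\xi_k\xi_{k-1}\cdots\xi_l\alpha_lH$ converges a.s. in $G/H$ as $l\to-\infty$. Let $s:G/H\to G$ be a Borel measurable section of the projection $G\to G/H$. Let $(\xi_k)_{k\in-\mathbb N}$ be independent $G$-valued random variables such that each $\xi_k$ has law $\mu_k$, and let $U_0$ be a $G$-valued random variable which is independent of $(\xi_k)$ and uniform on $H$. For each $k\in-\mathbb N$ define $$\phi_k=s\Bigl(\lim_{l\to-\infty}\xi_k\xi_{k-1}\cdots\xi_l\alpha_lH\Bigr),\qquad U_k=\phi_k^{-1}(\xi_0\xi_{-1}\cdots\xi_{k+1})^{-1}\phi_0U_0,\qquad \eta^0_k=\phi_kU_k,$$ where on the null event on which the limit does not exist it is replaced by a fixed element of $G/H$, and where the empty product (for $k=0$) is the unit.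 Then $\{(\eta^0_k),(\xi_k)\}$ is an extremal solution, and each $\eta^0_k$ has law $\lambda_k$. Moreover, for every $k\in-\mathbb N$, the random variable $U_k$ is independent of $\mathcal F^\xi_0$ and uniform on $H$, and $$\mathcal F^{\eta^0}_k=\sigma(U_k)\vee\mathcal F^\xi_k,$$ where $\sigma(U_k)$ and $\mathcal F^\xi_k$ are independent. -/

import Mathlib

open MeasureTheory ProbabilityTheory Filter Topology
open scoped NNReal

universe u v

/-!
Time runs through the non-positive integers; the time `-n` is encoded by the natural number `n`.
So `x n` stands for the value at time `-n`, the predecessor of time `-n` is `n + 1`, the past up to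
and including time `-n` consists of the indices `m ≥ n`, and time tends to `-∞` along `atTop`.
-/

namespace CompactGroupEquation

noncomputable section

/-- The `σ`-field generated by the past of `X` up to time `-n`, i.e. by all `X m` with `m ≥ n`. -/
@[reducible] def pastField {Ω : Type*} {E : Type*} [MeasurableSpace E] (X : ℕ → Ω → E) (n : ℕ) :
    MeasurableSpace Ω :=
  ⨆ m : ℕ, ⨆ _ : n ≤ m, MeasurableSpace.comap (X m) inferInstance

/-- The ordered product `x n * x (n + 1) * ⋯ * x (m - 1)` (equal to `1` if `m ≤ n`). -/
def orderedProd {G : Type*} [Monoid G] (x : ℕ → G) (n m : ℕ) : G :=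
  ((List.Ico n m).map x).prod

section Laws

variable {G : Type u} [Group G] [TopologicalSpace G] [IsTopologicalGroup G]
  [SecondCountableTopology G] [MeasurableSpace G] [BorelSpace G]

/-- Convolution of probability laws on `G`. -/
def conv (p q : ProbabilityMeasure G) : ProbabilityMeasure G :=
  ⟨(p : Measure G).mconv (q : Measure G), inferInstance⟩

/-- The ordered convolution product `μ n * μ (n + 1) * ⋯ * μ (m - 1)` (the unit mass at `1` if
`m ≤ n`). -/
def orderedConv (μ : ℕ → ProbabilityMeasure G) (n m : ℕ) : ProbabilityMeasure G :=
  ((List.Ico n m).map μ).foldr conv (diracProba 1)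

/-- The normalized Haar measure of a compact subgroup `H`, as a probability law on `G`. -/
def haarLaw (H : Subgroup G) [CompactSpace H] : ProbabilityMeasure G :=
  ⟨(Measure.haarMeasure (⊤ : TopologicalSpace.PositiveCompacts H)).map (Subtype.val : H → G), by
    have h : IsProbabilityMeasure
        (Measure.haarMeasure (⊤ : TopologicalSpace.PositiveCompacts H)) :=
      ⟨by simpa using Measure.haarMeasure_self (K₀ := (⊤ : TopologicalSpace.PositiveCompacts H))⟩
    exact Measure.isProbabilityMeasure_map measurable_subtype_coe.aemeasurable⟩

/-- `ξ` is a noise with law `μ`: the `ξ n` are independent random variables and `ξ n` has law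
`μ n`. -/
structure IsNoise (μ : ℕ → ProbabilityMeasure G) {Ω : Type v} [MeasurableSpace Ω]
    (P : Measure Ω) (ξ : ℕ → Ω → G) : Prop where
  measurable : ∀ n, Measurable (ξ n)
  indep : iIndepFun ξ P
  law : ∀ n, P.map (ξ n) = μ n

/-- The pair `(η, ξ)` is a solution of `η_k = ξ_k η_{k-1}` with noise law `μ`. -/
structure IsSolution (μ : ℕ → ProbabilityMeasure G) {Ω : Type v} [MeasurableSpace Ω]
    (P : Measure Ω) (η ξ : ℕ → Ω → G) : Prop where
  measurable_state : ∀ n, Measurable (η n)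
  measurable_noise : ∀ n, Measurable (ξ n)
  equation : ∀ n, ∀ᵐ ω ∂P, η n ω = ξ n ω * η (n + 1) ω
  indep : ∀ n, Indep (MeasurableSpace.comap (ξ n) inferInstance) (pastField η (n + 1)) P
  law : ∀ n, P.map (ξ n) = μ n

/-- The set of the laws on path space of the processes `η`, for all solutions `(η, ξ)` with noise
law `μ`. Every solution has the same law as one defined on the path space `ℕ → G`, so probability
spaces in the universe of `G` give all the laws. -/
def solutionLaws (μ : ℕ → ProbabilityMeasure G) : Set (Measure (ℕ → G)) :=
  {Q | ∃ (Ω : Type u) (_ : MeasurableSpace Ω) (P : Measure Ω) (_ : IsProbabilityMeasure P)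
    (η ξ : ℕ → Ω → G), IsSolution μ P η ξ ∧ Q = P.map (fun ω n => η n ω)}

/-- A solution is extremal if the law of `η` is an extreme point of the convex set of all laws
of solutions. -/
structure IsExtremalSolution (μ : ℕ → ProbabilityMeasure G) {Ω : Type v} [MeasurableSpace Ω]
    (P : Measure Ω) (η ξ : ℕ → Ω → G) : Prop where
  isSolution : IsSolution μ P η ξ
  extreme : P.map (fun ω n => η n ω) ∈ Set.extremePoints ℝ≥0 (solutionLaws μ)

/-- The data `lam`, `α`, `H` are a limit system of the infinite convolution product of `μ`. -/
structure IsLimitSystem (μ lam : ℕ → ProbabilityMeasure G) (α : ℕ → G) (H : Subgroup G)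
    [CompactSpace H] : Prop where
  /-- `μ_k * μ_{k-1} * ⋯ * μ_l * δ_{α_l} → λ_k` weakly as `l → -∞`, for each `k`. -/
  tendsto_law : ∀ n, Tendsto (fun m => conv (orderedConv μ n (m + 1)) (diracProba (α m))) atTop
    (𝓝 (lam n))
  /-- `δ_{α_l⁻¹} * λ_{l-1} → ω_H` weakly as `l → -∞`. -/
  tendsto_haar : Tendsto (fun m => conv (diracProba (α m)⁻¹) (lam (m + 1))) atTop (𝓝 (haarLaw H))
  /-- `λ_k * δ_h = λ_k` for each `h ∈ H` and each `k`. -/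
  invariant : ∀ h ∈ H, ∀ n, conv (lam n) (diracProba h) = lam n
  /-- For every noise `ξ` with law `μ` and each `k`, the cosets `ξ_k ξ_{k-1} ⋯ ξ_l α_l H`
  converge a.s. in `G ⧸ H` as `l → -∞`. -/
  tendsto_coset : ∀ (Ω : Type v) [MeasurableSpace Ω] (P : Measure Ω) [IsProbabilityMeasure P]
    (ξ : ℕ → Ω → G), IsNoise μ P ξ → ∀ n, ∀ᵐ ω ∂P, ∃ x : G ⧸ H,
      Tendsto (fun m => ((orderedProd (fun j => ξ j ω) n (m + 1) * α m : G) : G ⧸ H)) atTop (𝓝 x)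

end Laws

section Construction

variable {G : Type u} [Group G] [TopologicalSpace G] {Ω : Type v}

/-- A Borel measurable section of the projection `G → G ⧸ H`. -/
structure IsMeasurableSection [MeasurableSpace G] (H : Subgroup G) (s : G ⧸ H → G) : Prop where
  measurable : @Measurable (G ⧸ H) G (borel (G ⧸ H)) _ s
  mk_section : ∀ x : G ⧸ H, (s x : G ⧸ H) = x

/-- `φ_k = s (lim_{l → -∞} ξ_k ξ_{k-1} ⋯ ξ_l α_l H)`. Where the limit does not exist, `limUnder`
takes a value that does not depend on `ω`. -/
def phi (H : Subgroup G) (s : G ⧸ H → G) (α : ℕ → G) (ξ : ℕ → Ω → G) (n : ℕ) (ω : Ω) : G :=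
  s (limUnder atTop
    (fun m => ((orderedProd (fun j => ξ j ω) n (m + 1) * α m : G) : G ⧸ H)))

/-- `U_k = φ_k⁻¹ (ξ_0 ξ_{-1} ⋯ ξ_{k+1})⁻¹ φ_0 U_0`. -/
def complement (H : Subgroup G) (s : G ⧸ H → G) (α : ℕ → G) (ξ : ℕ → Ω → G) (U₀ : Ω → G) (n : ℕ)
    (ω : Ω) : G :=
  (phi H s α ξ n ω)⁻¹ * (orderedProd (fun j => ξ j ω) 0 n)⁻¹ * phi H s α ξ 0 ω * U₀ ω

/-- `η⁰_k = φ_k U_k`. -/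
def state (H : Subgroup G) (s : G ⧸ H → G) (α : ℕ → G) (ξ : ℕ → Ω → G) (U₀ : Ω → G) (n : ℕ)
    (ω : Ω) : G :=
  phi H s α ξ n ω * complement H s α ξ U₀ n ω

end Construction

end

end CompactGroupEquation

universe w

set_option linter.unusedSectionVars false

/-! In `state` the factor φ_k cancels, leaving (ξ_0 ⋯ ξ_{k+1})⁻¹ φ_0 U_0, so the recursion holds
identically. Coset convergence gives ξ_0 ⋯ ξ_{k+1} φ_k H = φ_0 H a.s., hence U_k is U_0 multiplied
on the left by an `H`-valued function of the noise; by invariance of Haar measure it is again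
uniform on `H` and independent of the noise (`map_prodMk_mul_eq_prod_haarLaw`). For the marginal
laws (`IsLimitSystem.map_state`), averaging a test function over `H` makes it a continuous function
on `G ⧸ H`, along which both the a.s. and the weak limit can be computed.

Extremality rests on two facts. The law of a solution is determined by its marginals
(`IsSolution.map_eq_of_forall_map_eq`), by the Markov structure. And a family γ solving the
convolution equation with cγ ≤ λ, c > 0, equals λ (`IsLimitSystem.eq_of_smul_le`): γ_k is the
convolution of a law tending to λ_k with δ_{α_l⁻¹} * γ_{l-1}; domination forces the latter to
concentrate near `H`, and λ_k is right `H`-invariant. -/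

namespace CompactGroupEquation

/-! ### Ordered products -/

section Lists

variable {G : Type*} [Monoid G]

lemma orderedProd_self (x : ℕ → G) (n : ℕ) : orderedProd x n n = 1 := by
  simp [orderedProd]

lemma orderedProd_mul_orderedProd (x : ℕ → G) {n k m : ℕ} (hnk : n ≤ k) (hkm : k ≤ m) :
    orderedProd x n k * orderedProd x k m = orderedProd x n m := by
  simp only [orderedProd]
  rw [← List.prod_append, ← List.map_append, List.Ico.append_consecutive hnk hkm]

lemma orderedProd_eq_mul (x : ℕ → G) {n m : ℕ} (h : n < m) :
    orderedProd x n m = x n * orderedProd x (n + 1) m := by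
  simp [orderedProd, List.Ico.eq_cons h]

lemma orderedProd_succ_top (x : ℕ → G) {n m : ℕ} (h : n ≤ m) :
    orderedProd x n (m + 1) = orderedProd x n m * x m := by
  simp [orderedProd, List.Ico.succ_top h]

lemma measurable_orderedProd [MeasurableSpace G] [MeasurableMul₂ G] {Ω : Type*}
    {mΩ : MeasurableSpace Ω} {ξ : ℕ → Ω → G} {n : ℕ} (h : ∀ j, n ≤ j → Measurable (ξ j)) (m : ℕ) :
    Measurable fun ω => orderedProd (fun j => ξ j ω) n m := by
  rcases le_total n m with hnm | hmn
  · induction m, hnm using Nat.le_induction with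
    | base => simp only [orderedProd_self, measurable_const]
    | succ k hk ih =>
      simp only [orderedProd_succ_top _ hk]
      exact ih.mul (h k hk)
  · simp [orderedProd, List.Ico.eq_nil_of_le hmn]

end Lists

/-! ### Past σ-fields and independence -/

section PastField

variable {Ω E : Type*} [MeasurableSpace E] {X : ℕ → Ω → E}

lemma measurable_pastField {n m : ℕ} (h : n ≤ m) : Measurable[pastField X n] (X m) := by
  rw [measurable_iff_comap_le]
  exact le_iSup₂_of_le m h le_rfl

lemma pastField_le_iff {n : ℕ} {𝓜 : MeasurableSpace Ω} :
    pastField X n ≤ 𝓜 ↔ ∀ m, n ≤ m → Measurable[𝓜] (X m) := by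
  simp only [pastField, iSup_le_iff, measurable_iff_comap_le]

lemma pastField_le [mΩ : MeasurableSpace Ω] (hX : ∀ n, Measurable (X n)) (n : ℕ) :
    pastField X n ≤ mΩ :=
  pastField_le_iff.2 fun m _ => hX m

lemma pastField_anti {n m : ℕ} (h : n ≤ m) : pastField X m ≤ pastField X n :=
  pastField_le_iff.2 fun _ hk => measurable_pastField (h.trans hk)

lemma pastField_zero_eq_comap :
    pastField X 0 = MeasurableSpace.comap (fun ω n => X n ω) inferInstance := by
  apply le_antisymm
  · rw [pastField_le_iff]
    intro m _
    exact (measurable_pi_apply m).comp (comap_measurable (fun ω n => X n ω))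
  · rw [← measurable_iff_comap_le]
    exact @measurable_pi_lambda _ _ _ (pastField X 0) _ _ fun m =>
      measurable_pastField (Nat.zero_le m)

end PastField

/-- On the π-system of sets a ∩ b generating `m₂ ⊔ m₃`, one splits off a by `h₂₃`, then separates s
from b by `h₁₃`. -/
lemma indep_sup_right {Ω : Type*} {m₁ m₂ m₃ mΩ : MeasurableSpace Ω} {P : Measure Ω}
    [IsProbabilityMeasure P] (h₁ : m₁ ≤ mΩ) (h₂ : m₂ ≤ mΩ) (h₃ : m₃ ≤ mΩ)
    (h₂₃ : Indep m₂ (m₁ ⊔ m₃) P) (h₁₃ : Indep m₁ m₃ P) : Indep m₁ (m₂ ⊔ m₃) P := by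
  have hpi : IsPiSystem (Set.image2 (· ∩ ·) {s | MeasurableSet[m₂] s} {s | MeasurableSet[m₃] s}) := by
    rintro _ ⟨a, ha, b, hb, rfl⟩ _ ⟨c, hc, d, hd, rfl⟩ -
    exact ⟨a ∩ c, ha.inter hc, b ∩ d, hb.inter hd, Set.inter_inter_inter_comm ..⟩
  refine IndepSets.indep h₁ (sup_le h₂ h₃) (@MeasurableSpace.isPiSystem_measurableSet _ m₁) hpi
    (@MeasurableSpace.generateFrom_measurableSet _ m₁).symm ?_ ?_
  · apply le_antisymm
    · refine sup_le (fun s hs => ?_) (fun s hs => ?_)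
      · exact MeasurableSpace.measurableSet_generateFrom
          ⟨s, hs, Set.univ, MeasurableSet.univ, Set.inter_univ s⟩
      · exact MeasurableSpace.measurableSet_generateFrom
          ⟨Set.univ, MeasurableSet.univ, s, hs, Set.univ_inter s⟩
    · refine MeasurableSpace.generateFrom_le ?_
      rintro _ ⟨a, ha, b, hb, rfl⟩
      exact MeasurableSet.inter (le_sup_left (a := m₂) (b := m₃) _ ha)
        (le_sup_right (a := m₂) (b := m₃) _ hb)
  · rw [IndepSets_iff]
    rintro s _ hs ⟨a, ha, b, hb, rfl⟩
    rw [Indep_iff] at h₂₃ h₁₃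
    have hs' : MeasurableSet[m₁ ⊔ m₃] s := le_sup_left (a := m₁) (b := m₃) _ hs
    have hb' : MeasurableSet[m₁ ⊔ m₃] b := le_sup_right (a := m₁) (b := m₃) _ hb
    calc P (s ∩ (a ∩ b)) = P (a ∩ (s ∩ b)) := by rw [Set.inter_left_comm]
      _ = P s * P (a ∩ b) := by
        rw [h₂₃ a _ ha (MeasurableSet.inter hs' hb'), h₁₃ s b hs hb, h₂₃ a b ha hb', mul_left_comm]

/-! ### Convolution, and the law of a solution on path space -/

section Laws

variable {G : Type u} [Group G] [TopologicalSpace G] [IsTopologicalGroup G]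
  [SecondCountableTopology G] [MeasurableSpace G] [BorelSpace G]

lemma coe_conv (p q : ProbabilityMeasure G) :
    (conv p q : Measure G) = (p : Measure G).mconv (q : Measure G) := rfl

lemma conv_assoc (p q r : ProbabilityMeasure G) : conv (conv p q) r = conv p (conv q r) :=
  Subtype.ext (Measure.mconv_assoc _ _ _)

lemma diracProba_one_conv (p : ProbabilityMeasure G) : conv (diracProba 1) p = p :=
  Subtype.ext (Measure.dirac_one_mconv _)

lemma diracProba_conv_diracProba (x y : G) :
    conv (diracProba x) (diracProba y) = diracProba (x * y) :=
  Subtype.ext (Measure.dirac_mconv_dirac x y)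

lemma orderedConv_self (μ : ℕ → ProbabilityMeasure G) (n : ℕ) :
    orderedConv μ n n = diracProba 1 := by
  simp [orderedConv]

lemma orderedConv_eq_conv (μ : ℕ → ProbabilityMeasure G) {n m : ℕ} (h : n < m) :
    orderedConv μ n m = conv (μ n) (orderedConv μ (n + 1) m) := by
  simp [orderedConv, List.Ico.eq_cons h]

lemma integral_conv (p q : ProbabilityMeasure G) {f : G → ℝ} (hf : Continuous f)
    {C : ℝ} (hC : ∀ x, ‖f x‖ ≤ C) :
    ∫ z, f z ∂(conv p q : Measure G) = ∫ y, ∫ x, f (x * y) ∂(p : Measure G) ∂(q : Measure G) := by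
  have hm : Measurable fun z : G × G => f (z.1 * z.2) := (hf.comp continuous_mul).measurable
  rw [coe_conv, Measure.mconv, integral_map measurable_mul.aemeasurable
    hf.measurable.aestronglyMeasurable, integral_prod_symm]
  exact Integrable.of_bound hm.aestronglyMeasurable C (ae_of_all _ fun z => hC _)

/-- In a solution, each noise variable is independent of every observable of the strict past. -/
lemma IsSolution.indepFun {μ : ℕ → ProbabilityMeasure G} {Ω : Type v} [MeasurableSpace Ω]
    {P : Measure Ω} {η ξ : ℕ → Ω → G} (h : IsSolution μ P η ξ) (n : ℕ) {E : Type*}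
    [MeasurableSpace E] {Y : Ω → E} (hY : Measurable[pastField η (n + 1)] Y) :
    IndepFun (ξ n) Y P := by
  rw [IndepFun_iff_Indep]
  exact indep_of_indep_of_le_right (h.indep n) (measurable_iff_comap_le.1 hY)

/-- The marginal laws of a solution solve the convolution equation. -/
lemma IsSolution.map_state {μ : ℕ → ProbabilityMeasure G} {Ω : Type v} [MeasurableSpace Ω]
    {P : Measure Ω} [IsProbabilityMeasure P] {η ξ : ℕ → Ω → G} (h : IsSolution μ P η ξ) (n : ℕ) :
    P.map (η n) = (μ n : Measure G).mconv (P.map (η (n + 1))) := by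
  have h1 := (h.indepFun n (measurable_pastField (X := η) le_rfl)).map_mul_eq_map_mconv_map
    (h.measurable_noise n) (h.measurable_state (n + 1))
  rw [← h.law n, ← h1]
  exact Measure.map_congr (h.equation n)

/-- One step of the equation on path space. -/
def prepend (z : G × (ℕ → G)) : ℕ → G
  | 0 => z.1 * z.2 0
  | i + 1 => z.2 i

lemma measurable_prepend : Measurable (prepend (G := G)) := by
  refine measurable_pi_lambda _ fun i => ?_
  cases i with
  | zero => exact measurable_fst.mul ((measurable_pi_apply 0).comp measurable_snd)
  | succ j => exact (measurable_pi_apply j).comp measurable_snd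

/-- Freezing the path after finitely many steps encodes a finite block as a full sequence, so that
blocks of all lengths live in one space. One step of the recursion lengthens the block by one, with
a factor `ξ n` independent of the rest. -/
lemma IsSolution.map_stopped_path {μ : ℕ → ProbabilityMeasure G} {Ω : Type v} [MeasurableSpace Ω]
    {P : Measure Ω} [IsProbabilityMeasure P] {η ξ : ℕ → Ω → G} (h : IsSolution μ P η ξ)
    (d n : ℕ) :
    P.map (fun ω i => η (n + min i (d + 1)) ω) =
      ((μ n : Measure G).prod (P.map (fun ω i => η (n + 1 + min i d) ω))).map prepend := by
  have hY : Measurable fun ω (i : ℕ) => η (n + 1 + min i d) ω :=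
    measurable_pi_lambda _ fun i => h.measurable_state _
  have hind : IndepFun (ξ n) (fun ω (i : ℕ) => η (n + 1 + min i d) ω) P :=
    h.indepFun n (@measurable_pi_lambda _ _ _ (pastField η (n + 1)) _ _ fun i =>
      measurable_pastField (by omega))
  rw [indepFun_iff_map_prod_eq_prod_map_map (h.measurable_noise n).aemeasurable hY.aemeasurable,
    h.law n] at hind
  rw [← hind, Measure.map_map measurable_prepend ((h.measurable_noise n).prodMk hY)]
  refine Measure.map_congr ?_
  filter_upwards [h.equation n] with ω hω
  funext i
  cases i with
  | zero => simpa [prepend] using hω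
  | succ j =>
    simp only [Function.comp_apply, prepend]
    congr 1
    omega

/-- The law of a solution is determined by its marginal laws. -/
lemma IsSolution.map_eq_of_forall_map_eq {μ : ℕ → ProbabilityMeasure G}
    {Ω : Type v} [MeasurableSpace Ω] {P : Measure Ω} [IsProbabilityMeasure P] {η ξ : ℕ → Ω → G}
    (h : IsSolution μ P η ξ)
    {Ω' : Type w} [MeasurableSpace Ω'] {P' : Measure Ω'} [IsProbabilityMeasure P']
    {η' ξ' : ℕ → Ω' → G} (h' : IsSolution μ P' η' ξ')
    (heq : ∀ n, P.map (η n) = P'.map (η' n)) :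
    P.map (fun ω n => η n ω) = P'.map (fun ω n => η' n ω) := by
  have key : ∀ d n, P.map (fun ω i => η (n + min i d) ω) =
      P'.map (fun ω i => η' (n + min i d) ω) := by
    intro d
    induction d with
    | zero =>
      intro n
      have hc : Measurable fun (x : G) (_ : ℕ) => x := measurable_pi_lambda _ fun _ => measurable_id
      have := congrArg (Measure.map fun (x : G) (_ : ℕ) => x) (heq n)
      rw [Measure.map_map hc (h.measurable_state n), Measure.map_map hc (h'.measurable_state n)]
        at this
      simpa [Function.comp_def] using this
    | succ d ih =>
      intro n
      rw [h.map_stopped_path, h'.map_stopped_path, ih]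
  have hη : Measurable fun ω n => η n ω := measurable_pi_lambda _ h.measurable_state
  have hη' : Measurable fun ω n => η' n ω := measurable_pi_lambda _ h'.measurable_state
  have hprob : IsProbabilityMeasure (P'.map fun ω n => η' n ω) :=
    Measure.isProbabilityMeasure_map hη'.aemeasurable
  refine IsProjectiveLimit.unique
    (P := fun I : Finset ℕ => (P'.map fun ω n => η' n ω).map I.restrict) (fun I => ?_)
    (fun I => rfl)
  have hI : Measurable (I.restrict (π := fun _ : ℕ => G)) := Finset.measurable_restrict I
  -- Freezing at the largest index of `I` leaves the coordinates in `I` untouched, so the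
  -- finite-dimensional laws agree.
  have hle : ∀ i ∈ I, min i (I.sup id) = i := fun i hi =>
    min_eq_left (Finset.le_sup (f := id) hi)
  have := congrArg (Measure.map (I.restrict (π := fun _ : ℕ => G))) (key (I.sup id) 0)
  rw [Measure.map_map hI (measurable_pi_lambda _ fun i => h.measurable_state _),
    Measure.map_map hI (measurable_pi_lambda _ fun i => h'.measurable_state _)] at this
  beta_reduce
  rw [Measure.map_map hI hη, Measure.map_map hI hη']
  convert this using 2
  · funext ω i
    simp [Finset.restrict, hle i i.2]
  · funext ω i
    simp [Finset.restrict, hle i i.2]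

/-- The law of a solution is realized by the coordinate process on path space. -/
lemma IsSolution.map_mem_solutionLaws {μ : ℕ → ProbabilityMeasure G} {Ω : Type v}
    [MeasurableSpace Ω] {P : Measure Ω} [IsProbabilityMeasure P] {η ξ : ℕ → Ω → G}
    (h : IsSolution μ P η ξ) : P.map (fun ω n => η n ω) ∈ solutionLaws μ := by
  have hη : Measurable fun ω n => η n ω := measurable_pi_lambda _ h.measurable_state
  have hn : ∀ n, Measurable fun x : ℕ → G => x n * (x (n + 1))⁻¹ := fun n =>
    (measurable_pi_apply n).mul (measurable_pi_apply (n + 1)).inv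
  have hcongr : ∀ n, (fun x : ℕ → G => x n * (x (n + 1))⁻¹) ∘ (fun ω n => η n ω) =ᵐ[P] ξ n := by
    intro n
    filter_upwards [h.equation n] with ω hω
    simp [hω]
  -- On path space the noise is rebuilt as the quotient of successive coordinates, which pulls back
  -- along `η` to `ξ n` almost surely.
  refine ⟨ℕ → G, inferInstance, P.map (fun ω n => η n ω),
    Measure.isProbabilityMeasure_map hη.aemeasurable, fun n x => x n,
    fun n x => x n * (x (n + 1))⁻¹, ⟨fun n => measurable_pi_apply n, hn,
      fun n => ae_of_all _ fun x => by simp, fun n => ?_, fun n => ?_⟩, Measure.map_id'.symm⟩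
  · rw [Indep_iff]
    rintro _ t ⟨s, hs, rfl⟩ ht
    have ht' : MeasurableSet t :=
      pastField_le (X := fun n (x : ℕ → G) => x n) (fun n => measurable_pi_apply n) _ _ ht
    have hpre : MeasurableSet[pastField η (n + 1)] ((fun ω n => η n ω) ⁻¹' t) := by
      have hle : pastField (fun n (x : ℕ → G) => x n) (n + 1) ≤
          (pastField η (n + 1)).map (fun ω n => η n ω) := by
        rw [pastField_le_iff]
        intro m hm u hu
        exact measurable_pastField (X := η) hm hu
      exact hle t ht
    have hs' := (hn n) hs
    have hae : (fun ω n => η n ω) ⁻¹' ((fun x : ℕ → G => x n * (x (n + 1))⁻¹) ⁻¹' s) =ᵐ[P]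
        (ξ n) ⁻¹' s := by
      filter_upwards [hcongr n] with ω hω
      exact congrArg (· ∈ s) hω
    have hae' : ((fun ω n => η n ω) ⁻¹' ((fun x : ℕ → G => x n * (x (n + 1))⁻¹) ⁻¹' s) ∩
        (fun ω n => η n ω) ⁻¹' t : Set Ω) =ᵐ[P] ((ξ n) ⁻¹' s ∩ (fun ω n => η n ω) ⁻¹' t : Set Ω) :=
      hae.inter (ae_eq_refl _)
    rw [Measure.map_apply hη (hs'.inter ht'), Measure.map_apply hη hs', Measure.map_apply hη ht',
      Set.preimage_inter, measure_congr hae, measure_congr hae']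
    exact (Indep_iff _ _ _).1 (h.indep n) _ _ ⟨s, hs, rfl⟩ hpre
  · rw [Measure.map_map (hn n) hη, Measure.map_congr (hcongr n), h.law n]

end Laws

/-! ### Haar measure of a compact subgroup -/

section HaarLaw

variable {G : Type u} [Group G] [TopologicalSpace G] [IsTopologicalGroup G]
  [SecondCountableTopology G] [MeasurableSpace G] [BorelSpace G]

instance (H : Subgroup G) [CompactSpace H] : IsProbabilityMeasure
    (Measure.haarMeasure (⊤ : TopologicalSpace.PositiveCompacts H)) :=
  ⟨by simpa using Measure.haarMeasure_self (K₀ := (⊤ : TopologicalSpace.PositiveCompacts H))⟩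

lemma coe_haarLaw (H : Subgroup G) [CompactSpace H] : (haarLaw H : Measure G) =
    (Measure.haarMeasure (⊤ : TopologicalSpace.PositiveCompacts H)).map (Subtype.val : H → G) := rfl

lemma integral_haarLaw (H : Subgroup G) [CompactSpace H] {f : G → ℝ} (hf : Continuous f) :
    ∫ x, f x ∂(haarLaw H : Measure G) =
      ∫ h : H, f h ∂(Measure.haarMeasure (⊤ : TopologicalSpace.PositiveCompacts H)) := by
  rw [coe_haarLaw, integral_map measurable_subtype_coe.aemeasurable
    hf.measurable.aestronglyMeasurable]

lemma map_mul_left_haarLaw (H : Subgroup G) [CompactSpace H] {g : G} (hg : g ∈ H) :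
    (haarLaw H : Measure G).map (g * ·) = haarLaw H := by
  have h1 : (fun x : G => g * x) ∘ (Subtype.val : H → G) =
      Subtype.val ∘ fun x : H => ⟨g, hg⟩ * x := rfl
  rw [coe_haarLaw, Measure.map_map (measurable_const_mul g) measurable_subtype_coe, h1,
    ← Measure.map_map measurable_subtype_coe (measurable_const_mul _), map_mul_left_eq_self]

/-- The average of a function over right multiplication by `H` is right `H`-invariant. -/
lemma integral_mul_haarLaw_mul (H : Subgroup G) [CompactSpace H] {f : G → ℝ} (hf : Continuous f)
    (g : G) {h : G} (hh : h ∈ H) :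
    ∫ u, f (g * h * u) ∂(haarLaw H : Measure G) = ∫ u, f (g * u) ∂(haarLaw H : Measure G) := by
  conv_rhs => rw [← map_mul_left_haarLaw H hh]
  rw [integral_map (f := fun u => f (g * u)) (measurable_const_mul h).aemeasurable
    (hf.comp (continuous_const_mul g)).measurable.aestronglyMeasurable]
  simp only [mul_assoc]

end HaarLaw

/-! ### Uniqueness of dominated solutions of the convolution equation -/

section Uniqueness

variable {G : Type u} [Group G] [TopologicalSpace G] [IsTopologicalGroup G] [CompactSpace G]
  [SecondCountableTopology G] [MeasurableSpace G] [BorelSpace G]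

lemma integrable_of_continuous (p : Measure G) [IsFiniteMeasure p] {f : G → ℝ}
    (hf : Continuous f) : Integrable f p :=
  (BoundedContinuousFunction.mkOfCompact ⟨f, hf⟩).integrable p

lemma tendsto_integral_of_tendsto {p : ℕ → ProbabilityMeasure G} {q : ProbabilityMeasure G}
    (h : Tendsto p atTop (𝓝 q)) {f : G → ℝ} (hf : Continuous f) :
    Tendsto (fun m => ∫ x, f x ∂(p m : Measure G)) atTop (𝓝 (∫ x, f x ∂(q : Measure G))) :=
  ProbabilityMeasure.tendsto_iff_forall_integral_tendsto.1 h
    (BoundedContinuousFunction.mkOfCompact ⟨f, hf⟩)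

/-- The Lipschitz constant 1 does not depend on `p`; this equicontinuity is what upgrades weak
convergence to uniform convergence over translates. -/
lemma abs_integral_sub_integral_le (p : ProbabilityMeasure G) (f g : C(G, ℝ)) :
    |∫ x, f x ∂(p : Measure G) - ∫ x, g x ∂(p : Measure G)| ≤ ‖f - g‖ := by
  rw [← integral_sub (integrable_of_continuous _ f.continuous)
    (integrable_of_continuous _ g.continuous), ← Real.norm_eq_abs]
  simpa using norm_integral_le_of_norm_le_const (μ := (p : Measure G))
    (ae_of_all _ fun x => (f - g).norm_coe_le_norm x)

/-- The continuous family of right translates of a continuous function. -/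
def rightTranslates (f : C(G, ℝ)) : C(G, C(G, ℝ)) :=
  ContinuousMap.curry ⟨fun z => f (z.2 * z.1), by fun_prop⟩

lemma rightTranslates_apply (f : C(G, ℝ)) (x y : G) : rightTranslates f y x = f (x * y) := rfl

lemma continuous_integral_mul (p : ProbabilityMeasure G) (f : C(G, ℝ)) :
    Continuous fun y => ∫ x, f (x * y) ∂(p : Measure G) := by
  have hlip : LipschitzWith 1 fun g : C(G, ℝ) => ∫ x, g x ∂(p : Measure G) :=
    LipschitzWith.of_dist_le_mul fun g g' => by
      simpa [Real.dist_eq, dist_eq_norm] using abs_integral_sub_integral_le p g g'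
  exact hlip.continuous.comp (rightTranslates f).continuous

/-- Weak convergence is uniform along the right translates of a continuous function. -/
lemma tendstoUniformly_integral_mul {p : ℕ → ProbabilityMeasure G} {q : ProbabilityMeasure G}
    (h : Tendsto p atTop (𝓝 q)) (f : C(G, ℝ)) :
    TendstoUniformly (fun m y => ∫ x, f (x * y) ∂(p m : Measure G))
      (fun y => ∫ x, f (x * y) ∂(q : Measure G)) atTop := by
  rw [← tendstoLocallyUniformly_iff_tendstoUniformly_of_compactSpace,
    Metric.tendstoLocallyUniformly_iff]
  intro ε hε y
  -- Three errors of ε/3: replacing y' by y under `p m`, the same under `q`, and the weak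
  -- convergence at y.
  have hnear : ∀ᶠ y' in 𝓝 y, ‖rightTranslates f y' - rightTranslates f y‖ < ε / 3 := by
    have := (rightTranslates f).continuous.tendsto y
    simpa [dist_eq_norm] using Metric.tendsto_nhds.1 this (ε / 3) (by positivity)
  refine ⟨_, hnear, ?_⟩
  have hpt := tendsto_integral_of_tendsto h (rightTranslates f y).continuous
  filter_upwards [Metric.tendsto_nhds.1 hpt (ε / 3) (by positivity)] with m hm y' hy'
  have h1 := abs_integral_sub_integral_le (p m) (rightTranslates f y') (rightTranslates f y)
  have h2 := abs_integral_sub_integral_le q (rightTranslates f y') (rightTranslates f y)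
  replace hy' : ‖rightTranslates f y' - rightTranslates f y‖ < ε / 3 := hy'
  simp only [rightTranslates_apply, Real.dist_eq] at h1 h2 hm ⊢
  rw [abs_lt] at hm ⊢
  rw [abs_le] at h1 h2
  constructor <;> linarith [h1.1, h1.2, h2.1, h2.2, hm.1, hm.2]

lemma eq_conv_orderedConv {μ γ : ℕ → ProbabilityMeasure G}
    (hγ : ∀ n, γ n = conv (μ n) (γ (n + 1))) {n m : ℕ} (h : n ≤ m) :
    γ n = conv (orderedConv μ n m) (γ m) := by
  induction h using Nat.decreasingInduction with
  | self => rw [orderedConv_self, diracProba_one_conv]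
  | of_succ k hk ih => rw [orderedConv_eq_conv μ hk, conv_assoc, ← ih, ← hγ k]

lemma diracProba_conv_mono {p q : ProbabilityMeasure G} {c : ℝ≥0}
    (h : c • (p : Measure G) ≤ q) (x : G) :
    c • (conv (diracProba x) p : Measure G) ≤ conv (diracProba x) q := by
  have h1 : ∀ r : ProbabilityMeasure G,
      (conv (diracProba x) r : Measure G) = (r : Measure G).map (x * ·) := fun r =>
    Measure.dirac_mconv x r
  rw [h1, h1, ← Measure.map_smul]
  exact Measure.map_mono h (measurable_const_mul x)

lemma integral_mul_eq_of_conv_eq {p : ProbabilityMeasure G} {h : G}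
    (hp : conv p (diracProba h) = p) {f : G → ℝ} (hf : Continuous f) :
    ∫ x, f (x * h) ∂(p : Measure G) = ∫ x, f x ∂(p : Measure G) := by
  have h1 := congrArg (fun r : ProbabilityMeasure G => ∫ x, f x ∂(r : Measure G)) hp
  simp only [coe_conv] at h1
  have h2 : ((p : Measure G).mconv (diracProba h : Measure G)) = (p : Measure G).map (· * h) :=
    Measure.mconv_dirac _ h
  rwa [h2, integral_map (measurable_mul_const h).aemeasurable
    hf.measurable.aestronglyMeasurable] at h1

/-- A solution of the convolution equation that is dominated by a multiple of the limit laws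
coincides with the limit laws. -/
lemma IsLimitSystem.eq_of_smul_le [T2Space G] {μ lam : ℕ → ProbabilityMeasure G} {α : ℕ → G}
    {H : Subgroup G} [CompactSpace H] (hsys : IsLimitSystem.{u, v} μ lam α H)
    {γ : ℕ → ProbabilityMeasure G} (hγ : ∀ n, γ n = conv (μ n) (γ (n + 1)))
    {c : ℝ≥0} (hc : 0 < c) (hle : ∀ n, c • (γ n : Measure G) ≤ lam n) (n : ℕ) :
    γ n = lam n := by
  refine Subtype.ext (ext_of_forall_integral_eq_of_IsFiniteMeasure (μ := (γ n : Measure G))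
    (ν := (lam n : Measure G)) fun f => ?_)
  set p : ℕ → ProbabilityMeasure G := fun m => conv (orderedConv μ n (m + 1)) (diracProba (α m))
  set ν : ℕ → ProbabilityMeasure G := fun m => conv (diracProba (α m)⁻¹) (γ (m + 1))
  set I : ℝ := ∫ x, f x ∂(lam n : Measure G)
  -- Insert δ_{α m} * δ_{(α m)⁻¹} = δ_1 between the first m + 1 - n noise laws and the remaining
  -- factor.
  have hfac : ∀ m, n ≤ m → γ n = conv (p m) (ν m) := by
    intro m hm
    simp only [p, ν]
    rw [eq_conv_orderedConv hγ (hm.trans (Nat.le_succ m)), conv_assoc,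
      ← conv_assoc (diracProba _), diracProba_conv_diracProba, mul_inv_cancel,
      diracProba_one_conv]
  set A : G → ℝ := fun y => ∫ x, f (x * y) ∂(lam n : Measure G)
  have hA : Continuous A := continuous_integral_mul (lam n) f.toContinuousMap
  have hAm : ∀ m, Continuous fun y => ∫ x, f (x * y) ∂(p m : Measure G) := fun m =>
    continuous_integral_mul (p m) f.toContinuousMap
  have hAH : ∀ h ∈ H, A h = I := by
    intro h hh
    exact integral_mul_eq_of_conv_eq (hsys.invariant h hh n) f.continuous
  -- The continuous function |A - I| vanishes on `H`, which carries the limit law.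
  have hJ : Tendsto (fun m => ∫ y, |A y - I| ∂(conv (diracProba (α m)⁻¹) (lam (m + 1)) : Measure G))
      atTop (𝓝 0) := by
    have hcont : Continuous fun y => |A y - I| := (hA.sub continuous_const).abs
    have := tendsto_integral_of_tendsto hsys.tendsto_haar hcont
    rw [integral_haarLaw H hcont] at this
    simpa [hAH _ (Subtype.prop _)] using this
  have hunif := tendstoUniformly_integral_mul (hsys.tendsto_law n) f.toContinuousMap
  have hmain : ∀ ε > 0, |∫ x, f x ∂(γ n : Measure G) - I| ≤ ε := by
    intro ε hε
    have hlim := (hJ.const_mul (c : ℝ)⁻¹).const_add ε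
    rw [mul_zero, add_zero] at hlim
    refine ge_of_tendsto hlim ?_
    filter_upwards [eventually_ge_atTop n, Metric.tendstoUniformly_iff.1 hunif ε hε] with m hm hm'
    -- Domination transfers the decay in `hJ` to `ν m`, at the price of the factor c⁻¹; convergence
    -- of `ν m` itself is not required.
    have hmeas : ∫ y, |A y - I| ∂(ν m : Measure G) ≤ (c : ℝ)⁻¹ *
        ∫ y, |A y - I| ∂(conv (diracProba (α m)⁻¹) (lam (m + 1)) : Measure G) := by
      have h1 := integral_mono_measure (diracProba_conv_mono (hle (m + 1)) (α m)⁻¹)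
        (ae_of_all _ fun y => abs_nonneg (A y - I))
        (integrable_of_continuous _ (hA.sub continuous_const).abs)
      rw [integral_smul_nnreal_measure] at h1
      rw [le_inv_mul_iff₀ (by exact_mod_cast hc)]
      exact h1
    calc |∫ x, f x ∂(γ n : Measure G) - I|
        = |∫ y, ((∫ x, f (x * y) ∂(p m : Measure G)) - I) ∂(ν m : Measure G)| := by
          rw [hfac m hm, integral_conv _ _ f.continuous f.norm_coe_le_norm,
            integral_sub (integrable_of_continuous _ (hAm m)) (integrable_const _)]
          simp
      _ ≤ ∫ y, |(∫ x, f (x * y) ∂(p m : Measure G)) - I| ∂(ν m : Measure G) :=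
          abs_integral_le_integral_abs
      _ ≤ ∫ y, (ε + |A y - I|) ∂(ν m : Measure G) := by
          refine integral_mono
            (integrable_of_continuous _ ((hAm m).sub continuous_const).abs)
            (integrable_of_continuous _ (continuous_const.add (hA.sub continuous_const).abs))
            fun y => ?_
          have h1 : |A y - ∫ x, f (x * y) ∂(p m : Measure G)| < ε := hm' y
          have h2 := abs_sub_le (∫ x, f (x * y) ∂(p m : Measure G)) (A y) I
          rw [abs_sub_comm _ (A y)] at h2
          simp only
          linarith
      _ = ε + ∫ y, |A y - I| ∂(ν m : Measure G) := by
          rw [integral_add (f := fun _ => ε) (g := fun y => |A y - I|) (integrable_const _)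
            (integrable_of_continuous _ (hA.sub continuous_const).abs)]
          simp
      _ ≤ _ := by gcongr
  have : |∫ x, f x ∂(γ n : Measure G) - I| = 0 := le_antisymm (le_of_forall_pos_le_add fun ε hε => by simpa using hmain ε hε)
    (abs_nonneg _)
  exact sub_eq_zero.1 (abs_eq_zero.1 this)

end Uniqueness

/-! ### Independent noise and skew translation by `H` -/

section Noise

variable {G : Type u} [Group G] [TopologicalSpace G] [IsTopologicalGroup G]
  [SecondCountableTopology G] [MeasurableSpace G] [BorelSpace G]
  {μ : ℕ → ProbabilityMeasure G} {Ω : Type v} [MeasurableSpace Ω] {P : Measure Ω}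
  {ξ : ℕ → Ω → G}

lemma IsNoise.indep_pastField (hξ : IsNoise μ P ξ) (n : ℕ) :
    Indep (MeasurableSpace.comap (ξ n) inferInstance) (pastField ξ (n + 1)) P := by
  have h := indep_iSup_of_disjoint (fun i => (hξ.measurable i).comap_le) hξ.indep.iIndep
    (S := {n}) (T := {m | n + 1 ≤ m}) (by simp)
  simpa [pastField, Nat.succ_le_iff] using h

lemma IsNoise.map_orderedProd [IsProbabilityMeasure P] (hξ : IsNoise μ P ξ) {n m : ℕ}
    (h : n ≤ m) : P.map (fun ω => orderedProd (fun j => ξ j ω) n m) = orderedConv μ n m := by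
  induction h using Nat.decreasingInduction with
  | self =>
    simp only [orderedProd_self, orderedConv_self, Measure.map_const, measure_univ, one_smul]
    rfl
  | of_succ k hk ih =>
    have hpast : Measurable[pastField ξ (k + 1)]
        fun ω => orderedProd (fun j => ξ j ω) (k + 1) m :=
      measurable_orderedProd (fun j hj => measurable_pastField hj) m
    have hind : IndepFun (ξ k) (fun ω => orderedProd (fun j => ξ j ω) (k + 1) m) P := by
      rw [IndepFun_iff_Indep]
      exact indep_of_indep_of_le_right (hξ.indep_pastField k) (measurable_iff_comap_le.1 hpast)
    rw [orderedConv_eq_conv μ hk, coe_conv, ← ih, ← hξ.law k, ← hind.map_mul_eq_map_mconv_map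
      (hξ.measurable k) (hpast.mono (pastField_le hξ.measurable _) le_rfl)]
    congr 1
    funext ω
    exact orderedProd_eq_mul _ hk

lemma IsNoise.map_orderedProd_mul [IsProbabilityMeasure P] (hξ : IsNoise μ P ξ) {n m : ℕ}
    (h : n ≤ m) (a : G) : P.map (fun ω => orderedProd (fun j => ξ j ω) n m * a) =
      conv (orderedConv μ n m) (diracProba a) := by
  have h1 : (conv (orderedConv μ n m) (diracProba a) : Measure G) =
      (orderedConv μ n m : Measure G).map (· * a) := Measure.mconv_dirac _ a
  rw [h1, ← hξ.map_orderedProd h, Measure.map_map (measurable_mul_const a)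
    (measurable_orderedProd (fun j _ => hξ.measurable j) m)]
  rfl

/-- Multiplying a uniform variable on `H` by an independent `H`-valued variable leaves its law
and its independence unchanged. -/
lemma map_prodMk_mul_eq_prod_haarLaw [IsProbabilityMeasure P] {H : Subgroup G} [CompactSpace H]
    [IsClosed (H : Set G)] {E : Type*} [MeasurableSpace E] {X : Ω → E} (hX : Measurable X)
    {U : Ω → G} (hU : Measurable U) (hUX : IndepFun U X P) (hUH : P.map U = haarLaw H)
    {k : E → G} (hk : Measurable k) (hkH : ∀ᵐ ω ∂P, k (X ω) ∈ H) :
    P.map (fun ω => (X ω, k (X ω) * U ω)) = (P.map X).prod (haarLaw H : Measure G) := by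
  have : IsProbabilityMeasure (P.map X) := Measure.isProbabilityMeasure_map hX.aemeasurable
  have hH : MeasurableSet {x | k x ∈ H} :=
    hk (‹IsClosed (H : Set G)›.measurableSet)
  have hmul : Measurable (Function.uncurry fun (x : E) (u : G) => k x * u) :=
    (hk.comp measurable_fst).mul measurable_snd
  -- For almost every x the fibre map u ↦ k x * u is translation by an element of `H`, so (x, u) ↦
  -- (x, k x * u) preserves the product law.
  have hskew := MeasurePreserving.skew_product (MeasurePreserving.id (P.map X)) hmul
    (μc := (haarLaw H : Measure G)) (μd := (haarLaw H : Measure G))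
    (by
      filter_upwards [(ae_map_iff hX.aemeasurable hH).2 hkH] with x hx
      exact map_mul_left_haarLaw H hx)
  have hind := (indepFun_iff_map_prod_eq_prod_map_map hX.aemeasurable hU.aemeasurable).1 hUX.symm
  rw [hUH] at hind
  rw [← hskew.map_eq, ← hind, Measure.map_map hskew.measurable (hX.prodMk hU)]
  rfl

end Noise

/-! ### The constructed solution -/

section Construction

variable {G : Type u} [Group G] [TopologicalSpace G] {Ω : Type v} {H : Subgroup G} {s : G ⧸ H → G}
  {α : ℕ → G} {ξ : ℕ → Ω → G} {U₀ : Ω → G}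

/-- The dependence on φ_n cancels, which is why the recursion for `state` holds at every ω and not
only almost surely. -/
lemma state_eq (n : ℕ) (ω : Ω) : state H s α ξ U₀ n ω =
    (orderedProd (fun j => ξ j ω) 0 n)⁻¹ * phi H s α ξ 0 ω * U₀ ω := by
  simp [state, complement, mul_assoc]

lemma state_eq_orderedProd_mul {n m : ℕ} (h : n ≤ m) (ω : Ω) : state H s α ξ U₀ n ω =
    orderedProd (fun j => ξ j ω) n m * state H s α ξ U₀ m ω := by
  rw [state_eq, state_eq, ← orderedProd_mul_orderedProd _ (Nat.zero_le n) h]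
  simp [mul_assoc]

lemma state_eq_mul (n : ℕ) (ω : Ω) :
    state H s α ξ U₀ n ω = ξ n ω * state H s α ξ U₀ (n + 1) ω := by
  rw [state_eq_orderedProd_mul (Nat.le_succ n), orderedProd_succ_top _ le_rfl, orderedProd_self,
    one_mul]

variable [IsTopologicalGroup G] [CompactSpace G] [SecondCountableTopology G]
  [MeasurableSpace G] [BorelSpace G] [IsClosed (H : Set G)]

/-- The σ-field on `Ω` is arbitrary and only indices j ≥ n enter, so the lemma also applies to past
σ-fields. -/
lemma measurable_phi {mΩ : MeasurableSpace Ω} (hs : IsMeasurableSection H s) {n : ℕ}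
    (hξ : ∀ j, n ≤ j → Measurable (ξ j)) : Measurable (phi H s α ξ n) := by
  let _ : MeasurableSpace (G ⧸ H) := borel (G ⧸ H)
  have : BorelSpace (G ⧸ H) := ⟨rfl⟩
  -- Closedness of `H` makes the compact second countable quotient metrizable; measurability of
  -- limits is available there.
  let _ := TopologicalSpace.metrizableSpaceMetric (G ⧸ H)
  have hlim : StronglyMeasurable fun ω => limUnder atTop
      (fun m => ((orderedProd (fun j => ξ j ω) n (m + 1) * α m : G) : G ⧸ H)) :=
    StronglyMeasurable.limUnder fun m =>
      (QuotientGroup.continuous_mk.measurable.comp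
        ((measurable_orderedProd hξ (m + 1)).mul_const (α m))).stronglyMeasurable
  exact hs.measurable.comp hlim.measurable

lemma measurable_complement {mΩ : MeasurableSpace Ω} (hs : IsMeasurableSection H s)
    (hξ : ∀ j, Measurable (ξ j)) (hU₀ : Measurable U₀) (n : ℕ) :
    Measurable (complement H s α ξ U₀ n) :=
  (((measurable_phi hs fun j _ => hξ j).inv.mul
    (measurable_orderedProd (fun j _ => hξ j) n).inv).mul
      (measurable_phi hs fun j _ => hξ j)).mul hU₀

lemma measurable_state {mΩ : MeasurableSpace Ω} (hs : IsMeasurableSection H s)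
    (hξ : ∀ j, Measurable (ξ j)) (hU₀ : Measurable U₀) (n : ℕ) :
    Measurable (state H s α ξ U₀ n) :=
  (measurable_phi hs fun j _ => hξ j).mul (measurable_complement hs hξ hU₀ n)

lemma pastField_noise_le (n : ℕ) : pastField ξ n ≤ pastField (state H s α ξ U₀) n := by
  rw [pastField_le_iff]
  intro m hm
  have h1 : ξ m = fun ω => state H s α ξ U₀ m ω * (state H s α ξ U₀ (m + 1) ω)⁻¹ := by
    funext ω
    rw [state_eq_mul m ω, mul_inv_cancel_right]
  rw [h1]
  exact (measurable_pastField (X := state H s α ξ U₀) hm).mul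
    (measurable_pastField (X := state H s α ξ U₀) (hm.trans (Nat.le_succ m))).inv

/-- An exact equality, not one modulo null sets: the identities expressing each side through the
other hold at every ω, and φ_n involves only the noise of index at least n. -/
lemma pastField_state (hs : IsMeasurableSection H s) (n : ℕ) :
    pastField (state H s α ξ U₀) n =
      MeasurableSpace.comap (complement H s α ξ U₀ n) inferInstance ⊔ pastField ξ n := by
  apply le_antisymm
  · rw [pastField_le_iff]
    intro m hm
    have hξ : ∀ j, n ≤ j → Measurable[MeasurableSpace.comap (complement H s α ξ U₀ n) inferInstance
        ⊔ pastField ξ n] (ξ j) := fun j hj => (measurable_pastField hj).mono le_sup_right le_rfl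
    have hU : Measurable[MeasurableSpace.comap (complement H s α ξ U₀ n) inferInstance
        ⊔ pastField ξ n] (complement H s α ξ U₀ n) :=
      (comap_measurable _).mono le_sup_left le_rfl
    have h1 : state H s α ξ U₀ m = fun ω => (orderedProd (fun j => ξ j ω) n m)⁻¹ *
        (phi H s α ξ n ω * complement H s α ξ U₀ n ω) := by
      funext ω
      change _ = _ * state H s α ξ U₀ n ω
      rw [state_eq_orderedProd_mul hm ω, inv_mul_cancel_left]
    rw [h1]
    exact (measurable_orderedProd hξ m).inv.mul ((measurable_phi hs hξ).mul hU)
  · refine sup_le ?_ (pastField_noise_le n)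
    rw [← measurable_iff_comap_le]
    have hφ : Measurable[pastField (state H s α ξ U₀) n] (phi H s α ξ n) :=
      measurable_phi hs fun j hj => (measurable_pastField hj).mono (pastField_noise_le n) le_rfl
    have h1 : complement H s α ξ U₀ n =
        fun ω => (phi H s α ξ n ω)⁻¹ * state H s α ξ U₀ n ω := by
      funext ω
      simp [state]
    rw [h1]
    exact hφ.inv.mul (measurable_pastField (X := state H s α ξ U₀) le_rfl)

variable [MeasurableSpace Ω] {P : Measure Ω} [IsProbabilityMeasure P]
  {μ lam : ℕ → ProbabilityMeasure G} [CompactSpace H]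

lemma IsLimitSystem.ae_tendsto_mk_phi (hsys : IsLimitSystem.{u, v} μ lam α H)
    (hs : IsMeasurableSection H s) (hξ : IsNoise μ P ξ) (n : ℕ) : ∀ᵐ ω ∂P,
      Tendsto (fun m => ((orderedProd (fun j => ξ j ω) n (m + 1) * α m : G) : G ⧸ H)) atTop
        (𝓝 ((phi H s α ξ n ω : G) : G ⧸ H)) := by
  filter_upwards [hsys.tendsto_coset Ω P ξ hξ n] with ω hω
  rw [phi, hs.mk_section]
  exact tendsto_nhds_limUnder hω

/-- Left translation by `orderedProd` from 0 to n is continuous on `G ⧸ H` and carries the sequence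
defining φ_n to the one defining φ_0, so it carries limit to limit. -/
lemma IsLimitSystem.ae_phi_inv_mul_mem (hsys : IsLimitSystem.{u, v} μ lam α H)
    (hs : IsMeasurableSection H s) (hξ : IsNoise μ P ξ) (n : ℕ) : ∀ᵐ ω ∂P,
      (phi H s α ξ n ω)⁻¹ * (orderedProd (fun j => ξ j ω) 0 n)⁻¹ * phi H s α ξ 0 ω ∈ H := by
  filter_upwards [hsys.ae_tendsto_mk_phi hs hξ n, hsys.ae_tendsto_mk_phi hs hξ 0] with ω hn h0
  have h1 := hn.const_smul (orderedProd (fun j => ξ j ω) 0 n)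
  have h2 : (orderedProd (fun j => ξ j ω) 0 n • ((phi H s α ξ n ω : G) : G ⧸ H)) =
      ((phi H s α ξ 0 ω : G) : G ⧸ H) := by
    refine tendsto_nhds_unique (h1.congr' ?_) h0
    filter_upwards [eventually_ge_atTop n] with m hm
    rw [← orderedProd_mul_orderedProd _ (Nat.zero_le n) (hm.trans (Nat.le_succ m)), mul_assoc]
    rfl
  have h3 := QuotientGroup.eq.1 (show ((orderedProd (fun j => ξ j ω) 0 n * phi H s α ξ n ω : G) :
    G ⧸ H) = ((phi H s α ξ 0 ω : G) : G ⧸ H) from h2)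
  rwa [mul_inv_rev] at h3

/-- The variable `U_n` is uniform on `H` and independent of the noise. -/
lemma IsLimitSystem.map_prodMk_complement (hsys : IsLimitSystem.{u, v} μ lam α H)
    (hs : IsMeasurableSection H s) (hξ : IsNoise μ P ξ) (hU₀ : Measurable U₀)
    (hU₀ξ : IndepFun U₀ (fun ω n => ξ n ω) P) (hU₀H : P.map U₀ = haarLaw H) (n : ℕ) :
    P.map (fun ω => ((fun j => ξ j ω), complement H s α ξ U₀ n ω)) =
      (P.map fun ω j => ξ j ω).prod (haarLaw H : Measure G) := by
  have hcoord : ∀ j, Measurable fun x : ℕ → G => x j := fun j => measurable_pi_apply j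
  exact map_prodMk_mul_eq_prod_haarLaw
    -- The multiplier of `U₀` as a function on path space: `phi` of the coordinate process,
    -- evaluated along ω ↦ ξ(ω).
    (k := fun x : ℕ → G => (phi H s α (fun j x => x j) n x)⁻¹ *
      (orderedProd (fun j => x j) 0 n)⁻¹ * phi H s α (fun j x => x j) 0 x)
    (measurable_pi_lambda _ hξ.measurable) hU₀ hU₀ξ hU₀H
    (((measurable_phi hs fun j _ => hcoord j).inv.mul
      (measurable_orderedProd (fun j _ => hcoord j) n).inv).mul
      (measurable_phi hs fun j _ => hcoord j))
    (hsys.ae_phi_inv_mul_mem hs hξ n)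

lemma IsLimitSystem.map_complement (hsys : IsLimitSystem.{u, v} μ lam α H)
    (hs : IsMeasurableSection H s) (hξ : IsNoise μ P ξ) (hU₀ : Measurable U₀)
    (hU₀ξ : IndepFun U₀ (fun ω n => ξ n ω) P) (hU₀H : P.map U₀ = haarLaw H) (n : ℕ) :
    P.map (complement H s α ξ U₀ n) = haarLaw H := by
  have hpath : Measurable fun ω j => ξ j ω := measurable_pi_lambda _ hξ.measurable
  have : IsProbabilityMeasure (P.map fun ω j => ξ j ω) :=
    Measure.isProbabilityMeasure_map hpath.aemeasurable
  have h1 := congrArg (Measure.map Prod.snd)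
    (hsys.map_prodMk_complement hs hξ hU₀ hU₀ξ hU₀H n)
  rwa [Measure.map_map measurable_snd
    (hpath.prodMk (measurable_complement hs hξ.measurable hU₀ n)), Measure.map_snd_prod,
    measure_univ, one_smul] at h1

lemma IsLimitSystem.indep_complement (hsys : IsLimitSystem.{u, v} μ lam α H)
    (hs : IsMeasurableSection H s) (hξ : IsNoise μ P ξ) (hU₀ : Measurable U₀)
    (hU₀ξ : IndepFun U₀ (fun ω n => ξ n ω) P) (hU₀H : P.map U₀ = haarLaw H) (n : ℕ) :
    Indep (MeasurableSpace.comap (complement H s α ξ U₀ n) inferInstance) (pastField ξ 0) P := by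
  have hpath : Measurable fun ω j => ξ j ω := measurable_pi_lambda _ hξ.measurable
  have h1 : IndepFun (fun ω j => ξ j ω) (complement H s α ξ U₀ n) P := by
    rw [indepFun_iff_map_prod_eq_prod_map_map hpath.aemeasurable
      (measurable_complement hs hξ.measurable hU₀ n).aemeasurable,
      hsys.map_complement hs hξ hU₀ hU₀ξ hU₀H n]
    exact hsys.map_prodMk_complement hs hξ hU₀ hU₀ξ hU₀H n
  rw [pastField_zero_eq_comap]
  exact ((IndepFun_iff_Indep _ _ _).1 h1).symm

lemma IsLimitSystem.isSolution_state (hsys : IsLimitSystem.{u, v} μ lam α H)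
    (hs : IsMeasurableSection H s) (hξ : IsNoise μ P ξ) (hU₀ : Measurable U₀)
    (hU₀ξ : IndepFun U₀ (fun ω n => ξ n ω) P) (hU₀H : P.map U₀ = haarLaw H) :
    IsSolution μ P (state H s α ξ U₀) ξ where
  measurable_state := measurable_state hs hξ.measurable hU₀
  measurable_noise := hξ.measurable
  equation n := ae_of_all _ fun ω => state_eq_mul n ω
  indep n := by
    rw [pastField_state hs]
    -- The past of the state is generated by U_{n+1} and the noise from n + 1 on; U_{n+1} is
    -- independent of `ξ n` jointly with that noise.
    refine indep_sup_right (hξ.measurable n).comap_le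
      (measurable_complement hs hξ.measurable hU₀ _).comap_le (pastField_le hξ.measurable _)
      (indep_of_indep_of_le_right (hsys.indep_complement hs hξ hU₀ hU₀ξ hU₀H (n + 1)) ?_)
      (hξ.indep_pastField n)
    exact sup_le (measurable_iff_comap_le.1 (measurable_pastField (Nat.zero_le n)))
      (pastField_anti (Nat.zero_le _))
  law := hξ.law

lemma continuous_integral_mul_haarLaw {f : G → ℝ} (hf : Continuous f) :
    Continuous fun g => ∫ u, f (g * u) ∂(haarLaw H : Measure G) := by
  obtain ⟨C, hC⟩ : ∃ C, ∀ x, ‖f x‖ ≤ C :=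
    ⟨_, (BoundedContinuousFunction.mkOfCompact ⟨f, hf⟩).norm_coe_le_norm⟩
  refine continuous_of_dominated (bound := fun _ => C)
    (fun g => (hf.comp (continuous_const_mul g)).measurable.aestronglyMeasurable)
    (fun g => ae_of_all _ fun u => hC _) (integrable_const _)
    (ae_of_all _ fun u => hf.comp (continuous_mul_const u))

/-- The limit laws are the marginal laws of the constructed solution. -/
lemma IsLimitSystem.map_state [T2Space G] (hsys : IsLimitSystem.{u, v} μ lam α H)
    (hs : IsMeasurableSection H s) (hξ : IsNoise μ P ξ) (hU₀ : Measurable U₀)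
    (hU₀ξ : IndepFun U₀ (fun ω n => ξ n ω) P) (hU₀H : P.map U₀ = haarLaw H) (n : ℕ) :
    P.map (state H s α ξ U₀ n) = lam n := by
  have hstate := measurable_state (α := α) hs hξ.measurable hU₀ n
  have hpath : Measurable fun ω j => ξ j ω := measurable_pi_lambda _ hξ.measurable
  have : IsProbabilityMeasure (P.map (state H s α ξ U₀ n)) :=
    Measure.isProbabilityMeasure_map hstate.aemeasurable
  have : IsProbabilityMeasure (P.map fun ω j => ξ j ω) :=
    Measure.isProbabilityMeasure_map hpath.aemeasurable
  refine ext_of_forall_integral_eq_of_IsFiniteMeasure fun f => ?_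
  set F : G → ℝ := fun g => ∫ u, f (g * u) ∂(haarLaw H : Measure G) with hF
  have hFc : Continuous F := continuous_integral_mul_haarLaw f.continuous
  have hFbd : ∀ g, ‖F g‖ ≤ ‖f‖ := fun g => by
    simpa using norm_integral_le_of_norm_le_const (μ := (haarLaw H : Measure G))
      (ae_of_all _ fun u => f.norm_coe_le_norm (g * u))
  -- U_n is integrated out, being uniform on `H` and independent of the noise.
  have hstep : ∫ x, f x ∂(P.map (state H s α ξ U₀ n)) = ∫ ω, F (phi H s α ξ n ω) ∂P := by
    have hΦ : Measurable (phi H s α (fun j (x : ℕ → G) => x j) n) :=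
      measurable_phi hs fun j _ => measurable_pi_apply j
    have hg : Measurable fun z : (ℕ → G) × G =>
        f (phi H s α (fun j (x : ℕ → G) => x j) n z.1 * z.2) :=
      f.continuous.measurable.comp ((hΦ.comp measurable_fst).mul measurable_snd)
    have h1 := congrArg (fun Q => ∫ z, f (phi H s α (fun j (x : ℕ → G) => x j) n z.1 * z.2) ∂Q)
      (hsys.map_prodMk_complement hs hξ hU₀ hU₀ξ hU₀H n)
    beta_reduce at h1
    rw [integral_map (hpath.prodMk (measurable_complement hs hξ.measurable hU₀ n)).aemeasurable
      hg.aestronglyMeasurable, integral_prod _ (Integrable.of_bound hg.aestronglyMeasurable ‖f‖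
        (ae_of_all _ fun z => f.norm_coe_le_norm _))] at h1
    rw [integral_map hstate.aemeasurable f.continuous.measurable.aestronglyMeasurable]
    exact h1.trans (integral_map hpath.aemeasurable
      (hFc.measurable.comp hΦ).aestronglyMeasurable)
  -- Only cosets converge, so `F` has to descend to `G ⧸ H`; its right `H`-invariance allows this.
  obtain ⟨F', hF', hF'F⟩ : ∃ F' : G ⧸ H → ℝ, Continuous F' ∧ ∀ g : G, F' (g : G ⧸ H) = F g := by
    refine ⟨Quotient.lift F fun a b hab => ?_, ?_, fun g => rfl⟩
    · have hab' := QuotientGroup.leftRel_apply.1 hab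
      have := integral_mul_haarLaw_mul H f.continuous a hab'
      rw [mul_inv_cancel_left] at this
      exact this.symm
    · exact (QuotientGroup.isQuotientMap_mk H).continuous_iff.2 hFc
  have hlim1 : Tendsto (fun m => ∫ ω, F (orderedProd (fun j => ξ j ω) n (m + 1) * α m) ∂P) atTop
      (𝓝 (∫ ω, F (phi H s α ξ n ω) ∂P)) := by
    refine tendsto_integral_of_dominated_convergence (fun _ => ‖f‖)
      (fun m => (hFc.measurable.comp ((measurable_orderedProd (fun j _ => hξ.measurable j)
        (m + 1)).mul_const (α m))).aestronglyMeasurable) (integrable_const _)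
      (fun m => ae_of_all _ fun ω => hFbd _) ?_
    filter_upwards [hsys.ae_tendsto_mk_phi hs hξ n] with ω hω
    have := (hF'.tendsto _).comp hω
    simpa only [Function.comp_def, hF'F] using this
  have hlim2 : Tendsto (fun m => ∫ ω, F (orderedProd (fun j => ξ j ω) n (m + 1) * α m) ∂P) atTop
      (𝓝 (∫ x, F x ∂(lam n : Measure G))) := by
    refine (tendsto_integral_of_tendsto (hsys.tendsto_law n) hFc).congr' ?_
    filter_upwards [eventually_ge_atTop n] with m hm
    rw [← hξ.map_orderedProd_mul (hm.trans (Nat.le_succ m)), integral_map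
      ((measurable_orderedProd (fun j _ => hξ.measurable j) (m + 1)).mul_const
        (α m)).aemeasurable hFc.measurable.aestronglyMeasurable]
  -- By Fubini the average over `H` falls on the right translates of `lam n`, all equal to `lam n`.
  have hswap : ∫ x, F x ∂(lam n : Measure G) = ∫ x, f x ∂(lam n : Measure G) := by
    rw [hF, integral_integral_swap, integral_haarLaw H
      (f := fun y => ∫ x, f (x * y) ∂(lam n : Measure G))
      (continuous_integral_mul (lam n) f.toContinuousMap)]
    · simp [integral_mul_eq_of_conv_eq (hsys.invariant _ (Subtype.prop _) n) f.continuous]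
    · exact Integrable.of_bound (f.continuous.comp continuous_mul).measurable.aestronglyMeasurable
        ‖f‖ (ae_of_all _ fun z => f.norm_coe_le_norm _)
  rw [hstep, tendsto_nhds_unique hlim1 hlim2, hswap]

lemma IsLimitSystem.isExtremalSolution_state [T2Space G] (hsys : IsLimitSystem.{u, v} μ lam α H)
    (hs : IsMeasurableSection H s) (hξ : IsNoise μ P ξ) (hU₀ : Measurable U₀)
    (hU₀ξ : IndepFun U₀ (fun ω n => ξ n ω) P) (hU₀H : P.map U₀ = haarLaw H) :
    IsExtremalSolution μ P (state H s α ξ U₀) ξ := by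
  have hsol := hsys.isSolution_state hs hξ hU₀ hU₀ξ hU₀H
  refine ⟨hsol, hsol.map_mem_solutionLaws, ?_⟩
  rintro _ ⟨Ω₁, _, P₁, _, η, ξ₁, hη, rfl⟩ Q₂ - ⟨a, b, ha, -, -, hab⟩
  have hstate : Measurable fun ω n => state H s α ξ U₀ n ω :=
    measurable_pi_lambda _ hsol.measurable_state
  have hηm : Measurable fun ω n => η n ω := measurable_pi_lambda _ hη.measurable_state
  let γ : ℕ → ProbabilityMeasure G := fun n =>
    ⟨P₁.map (η n), Measure.isProbabilityMeasure_map (hη.measurable_state n).aemeasurable⟩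
  refine hη.map_eq_of_forall_map_eq hsol fun n => ?_
  rw [hsys.map_state hs hξ hU₀ hU₀ξ hU₀H n]
  refine congrArg Subtype.val (hsys.eq_of_smul_le (γ := γ)
    (fun k => Subtype.ext (hη.map_state k)) ha (fun k => ?_) n)
  -- The convex combination enters only through this domination; the weight a > 0 serves as the
  -- constant c for the marginals.
  have hle : a • P₁.map (fun ω n => η n ω) ≤ P.map (fun ω n => state H s α ξ U₀ n ω) := by
    rw [← hab]
    exact Measure.le_add_right le_rfl
  have h1 := Measure.map_mono hle (measurable_pi_apply k)
  rw [Measure.map_smul, Measure.map_map (measurable_pi_apply k) hηm,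
    Measure.map_map (measurable_pi_apply k) hstate] at h1
  rw [← hsys.map_state hs hξ hU₀ hU₀ξ hU₀H k]
  exact h1

end Construction

end CompactGroupEquation

theorem mainTheorem5 {G : Type u} [Group G] [TopologicalSpace G] [IsTopologicalGroup G]
    [CompactSpace G] [T2Space G] [SecondCountableTopology G] [MeasurableSpace G] [BorelSpace G]
    (μ lam : ℕ → ProbabilityMeasure G) (α : ℕ → G) (H : Subgroup G) [CompactSpace H]
    (hsys : CompactGroupEquation.IsLimitSystem.{u, v} μ lam α H)
    (s : G ⧸ H → G) (hs : CompactGroupEquation.IsMeasurableSection H s)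
    {Ω : Type v} [MeasurableSpace Ω] (P : Measure Ω) [IsProbabilityMeasure P]
    (ξ : ℕ → Ω → G) (hξ : CompactGroupEquation.IsNoise μ P ξ)
    (U₀ : Ω → G) (hU₀ : Measurable U₀) (hU₀ξ : IndepFun U₀ (fun ω n => ξ n ω) P)
    (hU₀H : P.map U₀ = CompactGroupEquation.haarLaw H) :
    CompactGroupEquation.IsExtremalSolution μ P (CompactGroupEquation.state H s α ξ U₀) ξ ∧
    (∀ n, P.map (CompactGroupEquation.state H s α ξ U₀ n) = lam n) ∧
    ∀ n,
      Measurable (CompactGroupEquation.complement H s α ξ U₀ n) ∧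
      Indep (MeasurableSpace.comap (CompactGroupEquation.complement H s α ξ U₀ n) inferInstance) (CompactGroupEquation.pastField ξ 0) P ∧
      P.map (CompactGroupEquation.complement H s α ξ U₀ n) = CompactGroupEquation.haarLaw H ∧
      CompactGroupEquation.pastField (CompactGroupEquation.state H s α ξ U₀) n =
        MeasurableSpace.comap (CompactGroupEquation.complement H s α ξ U₀ n) inferInstance ⊔ CompactGroupEquation.pastField ξ n ∧
      Indep (MeasurableSpace.comap (CompactGroupEquation.complement H s α ξ U₀ n) inferInstance) (CompactGroupEquation.pastField ξ n) P := by
  -- `IsClosed` is a class, so this supplies the instance behind the metrizability of `G ⧸ H` and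
  -- the measurability of `H`.
  have hH : IsClosed (H : Set G) := (isCompact_iff_compactSpace.2 ‹CompactSpace H›).isClosed
  refine ⟨hsys.isExtremalSolution_state hs hξ hU₀ hU₀ξ hU₀H,
    hsys.map_state hs hξ hU₀ hU₀ξ hU₀H, fun n => ?_⟩
  have hind := hsys.indep_complement hs hξ hU₀ hU₀ξ hU₀H n
  exact ⟨CompactGroupEquation.measurable_complement hs hξ.measurable hU₀ n, hind,
    hsys.map_complement hs hξ hU₀ hU₀ξ hU₀H n, CompactGroupEquation.pastField_state hs n,
    indep_of_indep_of_le_right hind (CompactGroupEquation.pastField_anti (Nat.zero_le n))⟩
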